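/- Let $\Gamma$ be an artin algebra, i.e. a ring that is an algebra over a commutative artinian ring $R$ and finitely generated as an $R$-module; modules are finitely generated left modules. The dominant dimension $\operatorname{dom.dim}\Gamma$ is the supremum of all $k$ such that the terms $I_i$, $0\le i<k$, of a minimal injective resolution $0\to\Gamma\to I_0\to I_1\to\cdots$ of the left module $\Gamma$ are projective. Let $\widetilde Q$ be the direct sum of representatives of the isomorphism classes of all indecomposable projective-injective $\Gamma$-modules, and let $\mathcal C_\Gamma$ be the class of all modules $M$ that admit an epimorphism $\widetilde Q^m\to M$ and a monomorphism $M\to\widetilde Q^{m'}$ for some natural numbers $m,m'$. A tilting module is a basic module $T$ (a finite direct sum of pairwise non-isomorphic indecomposable modules) such that $\operatorname{pd}_\Gamma T\le 1$, $\operatorname{Ext}^1_\Gamma(T,T)=0$, and there is an exact sequence $0\to\Gamma\to T_0\to T_1\to 0$ with $T_0,T_1$ direct summands of finite direct sums of copies of $T$. Suppose that $\operatorname{dom.dim}\Gamma\ge 2$, let $T_{\mathcal C}$ be a tilting module belonging to $\mathcal C_\Gamma$, and put $B_{\mathcal C}=\operatorname{End}_\Gamma(T_{\mathcal C})^{op}$.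 Dimensions may be infinite, with $\infty\pm1=\infty$, and the zero module and the zero ring have dimension $-\infty$. Then: 1. For every module $M$ that is a quotient of $T_{\mathcal C}^m$ for some natural number $m$ and satisfies $\operatorname{pd}_\Gamma M\ge 1$, one has $\operatorname{pd}_{B_{\mathcal C}}\operatorname{Hom}_\Gamma(T_{\mathcal C},M)=\operatorname{pd}_\Gamma M-1$. 2. $\operatorname{gl.dim}B_{\mathcal C}\le\operatorname{gl.dim}\Gamma$. 3. Either $\operatorname{gl.dim}B_{\mathcal C}=\operatorname{gl.dim}\Gamma$ or $\operatorname{gl.dim}B_{\mathcal C}=\operatorname{gl.dim}\Gamma-1$. -/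

import Mathlib

universe u

open CategoryTheory

section ModuleNotions

variable {Γ : Type u} [Ring Γ]

/-- `M` is generated by `X`: there is an epimorphism `X ^ m → M` for some natural number `m`. -/
def GeneratedBy (X M : ModuleCat.{u} Γ) : Prop :=
  ∃ (m : ℕ) (f : (Fin m → X) →ₗ[Γ] M), Function.Surjective f

/-- `M` is cogenerated by `X`: there is a monomorphism `M → X ^ m` for some natural number `m`. -/
def CogeneratedBy (X M : ModuleCat.{u} Γ) : Prop :=
  ∃ (m : ℕ) (f : M →ₗ[Γ] (Fin m → X)), Function.Injective f

/-- `M` belongs to `add X`: it is a direct summand of a finite direct sum of copies of `X`. -/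
def InAdd (X M : ModuleCat.{u} Γ) : Prop :=
  ∃ (m : ℕ) (N : ModuleCat.{u} Γ), Nonempty ((M × N) ≃ₗ[Γ] (Fin m → X))

/-- `M` is a finitely generated indecomposable module that is both projective and injective. -/
structure IsIndecomposableProjInj (M : ModuleCat.{u} Γ) : Prop where
  finite : Module.Finite Γ M
  indecomposable : Indecomposable M
  projective : Projective M
  injective : Injective M

/-- `Q` is the direct sum of representatives of the isomorphism classes of all indecomposable
projective-injective finitely generated modules, each class being represented exactly once. -/
def IsProjInjSum (Q : ModuleCat.{u} Γ) : Prop :=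
  ∃ (t : ℕ) (P : Fin t → ModuleCat.{u} Γ),
    (∀ i, IsIndecomposableProjInj (P i)) ∧
    (∀ i j, Nonempty (P i ≅ P j) → i = j) ∧
    (∀ M : ModuleCat.{u} Γ, IsIndecomposableProjInj M → ∃ i, Nonempty (M ≅ P i)) ∧
    Nonempty (Q ≃ₗ[Γ] ((i : Fin t) → P i))

/-- `M` belongs to the subcategory `Gen Q ∩ Cogen Q`, where `Q` is the direct sum of the
indecomposable projective-injective modules (which is unique up to isomorphism). -/
def InGenCogenProjInj (M : ModuleCat.{u} Γ) : Prop :=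
  ∃ Q : ModuleCat.{u} Γ, IsProjInjSum Q ∧ GeneratedBy Q M ∧ CogeneratedBy Q M

/-- `M` is basic: a finite direct sum of pairwise non-isomorphic indecomposable modules. -/
def IsBasicModule (M : ModuleCat.{u} Γ) : Prop :=
  ∃ (n : ℕ) (X : Fin n → ModuleCat.{u} Γ),
    (∀ i, Indecomposable (X i)) ∧
    (∀ i j, Nonempty (X i ≅ X j) → i = j) ∧
    Nonempty (M ≃ₗ[Γ] ((i : Fin n) → X i))

/-- (Classical) tilting modules: basic finitely generated modules `T` with `pd T ≤ 1`,
`Ext¹(T, T) = 0` and an exact sequence `0 → Γ → T₀ → T₁ → 0` with `T₀, T₁` in `add T`. -/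
structure IsTiltingModule (T : ModuleCat.{u} Γ) : Prop where
  finite : Module.Finite Γ T
  basic : IsBasicModule T
  projectiveDimension_le : projectiveDimension T ≤ 1
  ext_subsingleton : Subsingleton (Abelian.Ext T T 1)
  exists_coresolution : ∃ (T₀ T₁ : ModuleCat.{u} Γ) (f : Γ →ₗ[Γ] T₀) (g : T₀ →ₗ[Γ] T₁),
    InAdd T T₀ ∧ InAdd T T₁ ∧
    Function.Injective f ∧ Function.Exact f g ∧ Function.Surjective g

/-- A submodule is essential if it meets every nonzero submodule nontrivially. -/
def IsEssentialSubmodule {M : Type u} [AddCommGroup M] [Module Γ M] (N : Submodule Γ M) : Prop :=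
  ∀ L : Submodule Γ M, N ⊓ L = ⊥ → L = ⊥

/-- An injective resolution `0 → M → I₀ → I₁ → ⋯` in the category of finitely generated modules is
minimal if, for every `n`, the module `Iₙ` is an injective envelope of the kernel of `Iₙ → Iₙ₊₁`
(which, by exactness, is the image of the preceding map, and `M` itself for `n = 0`). -/
structure IsMinimalInjectiveResolution {M : ModuleCat.{u} Γ} (I : InjectiveResolution M) :
    Prop where
  finite : ∀ n, Module.Finite Γ (I.cocomplex.X n)
  essential : ∀ n, IsEssentialSubmodule (LinearMap.ker (I.cocomplex.d n (n + 1)).hom)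

end ModuleNotions

/-- The (left) dominant dimension of `Γ`: the supremum of all `k` such that the terms `Iᵢ`, `i < k`,
of a minimal injective resolution of the left module `Γ` are projective. -/
noncomputable def dominantDimension (Γ : Type u) [Ring Γ] : ℕ∞ :=
  sSup {k : ℕ∞ | ∃ I : InjectiveResolution (ModuleCat.of Γ Γ), IsMinimalInjectiveResolution I ∧
    ∀ i : ℕ, (i : ℕ∞) < k → Projective (I.cocomplex.X i)}

/-- The (left) global dimension of `Γ`: the supremum of the projective dimensions of the finitely
generated left modules. The zero module has projective dimension `⊥`. -/
noncomputable def globalDimension (Γ : Type u) [Ring Γ] : WithBot ℕ∞ :=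
  ⨆ (M : ModuleCat.{u} Γ) (_ : Module.Finite Γ M), projectiveDimension M

/-- The ring `End(T)ᵒᵖ`. -/
abbrev EndOp {Γ : Type u} [Ring Γ] (T : ModuleCat.{u} Γ) : Type u := (End T)ᵐᵒᵖ

/-- `Hom(T, M)` as a left module over `End(T)ᵒᵖ`, where endomorphisms of `T` act by
precomposition. -/
noncomputable abbrev homModule {Γ : Type u} [Ring Γ] (T M : ModuleCat.{u} Γ) :
    ModuleCat.{u} (EndOp T) :=
  (preadditiveCoyonedaObj T).obj M

/-! Write B for `EndOp T`. The coresolution of Γ shows that a finitely generated K lies in Gen T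
exactly when Ext¹(T, K) = 0. Hence every M in Gen T sits in an exact sequence 0 → K → Tⁿ → M → 0
with K again in Gen T, and this stays exact under Hom(T, -) (`exists_approximation`). Since Hom(T,
-) is faithful on Gen T, full on add T and sends add T to projectives, dimension shifting along such
sequences compares pd M with pd Hom(T, M).

The drop by exactly one comes from the base case: T is generated by an injective Q, so Ext¹(X, -)
vanishes on Gen T whenever pd X ≤ 1. Thus pd M ≤ 1 splits the sequence and makes Hom(T, M)
projective; conversely, if Hom(T, M) is projective, then M lies in add T and pd M ≤ 1.

For global dimensions, each finitely generated B-module has a syzygy Hom(T, M) with M in Gen T, so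
the drop by one offsets the syzygy. Conversely, each finitely generated Γ-module embeds in a member
of Gen T with cokernel in add T, which costs at most one. -/

/-- `X` is a finite sum of copies of `T` up to direct summands, i.e. the identity of `X` is a finite
sum of endomorphisms that factor through `T`. -/
def FactorsThroughSum {C : Type*} [Category* C] [Preadditive C] (T X : C) : Prop :=
  ∃ (n : ℕ) (a : Fin n → (X ⟶ T)) (b : Fin n → (T ⟶ X)), ∑ i, a i ≫ b i = 𝟙 X

/-! ### Membership in add T through factorizations of the identity -/

namespace FactorsThroughSum

theorem map {C D : Type*} [Category* C] [Preadditive C] [Category* D] [Preadditive D] {T X : C}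
    (h : FactorsThroughSum T X)
    (F : C ⥤ D) [F.Additive] : FactorsThroughSum (F.obj T) (F.obj X) := by
  obtain ⟨n, a, b, hab⟩ := h
  refine ⟨n, fun i => F.map (a i), fun i => F.map (b i), ?_⟩
  simp_rw [← F.map_comp, ← F.map_sum, hab, F.map_id]

section Abelian

variable {C : Type*} [Category* C] [Abelian C] {T X : C}

open Abelian

theorem ext_left [HasExt.{u} C] (h : FactorsThroughSum T X) {Y : C} {k : ℕ}
    (hT : Subsingleton (Ext.{u} T Y k)) : Subsingleton (Ext.{u} X Y k) := by
  obtain ⟨n, a, b, hab⟩ := h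
  refine subsingleton_of_forall_eq 0 fun x => ?_
  rw [← Ext.mk₀_id_comp x, ← hab, Ext.mk₀_sum, Ext.sum_comp]
  refine Finset.sum_eq_zero fun i _ => ?_
  rw [← Ext.mk₀_comp_mk₀, Ext.comp_assoc (Ext.mk₀ (a i)) (Ext.mk₀ (b i)) x (zero_add 0)
    (zero_add k) (by omega), Subsingleton.elim ((Ext.mk₀ (b i)).comp x _) 0, Ext.comp_zero]

theorem ext_right [HasExt.{u} C] (h : FactorsThroughSum T X) {Y : C} {k : ℕ}
    (hT : Subsingleton (Ext.{u} Y T k)) : Subsingleton (Ext.{u} Y X k) := by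
  obtain ⟨n, a, b, hab⟩ := h
  refine subsingleton_of_forall_eq 0 fun x => ?_
  rw [← Ext.comp_mk₀_id x, ← hab, Ext.mk₀_sum, Ext.comp_sum]
  refine Finset.sum_eq_zero fun i _ => ?_
  rw [← Ext.mk₀_comp_mk₀, ← Ext.comp_assoc x (Ext.mk₀ (a i)) (Ext.mk₀ (b i)) (add_zero k)
    (zero_add 0) (by omega), Subsingleton.elim (x.comp (Ext.mk₀ (a i)) _) 0, Ext.zero_comp]

theorem hasProjectiveDimensionLT (h : FactorsThroughSum T X) (k : ℕ)
    (hT : HasProjectiveDimensionLT T k) : HasProjectiveDimensionLT X k := by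
  let := HasExt.standard C
  rw [hasProjectiveDimensionLT_iff]
  intro i hi Y e
  have := h.ext_left (HasProjectiveDimensionLT.subsingleton T k i hi Y)
  exact Subsingleton.elim _ _

theorem projective (h : FactorsThroughSum T X) (hT : Projective T) : Projective X := by
  rw [projective_iff_hasProjectiveDimensionLT_one] at hT ⊢
  exact h.hasProjectiveDimensionLT 1 hT

end Abelian

section Module

variable {Γ : Type u} [Ring Γ] {T X : ModuleCat.{u} Γ}

theorem of_pi (T : ModuleCat.{u} Γ) (n : ℕ) :
    FactorsThroughSum T (ModuleCat.of Γ (Fin n → T)) := by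
  refine ⟨n, fun i => ModuleCat.ofHom (LinearMap.proj i),
    fun i => ModuleCat.ofHom (LinearMap.single Γ (fun _ : Fin n => (T : Type u)) i), ?_⟩
  ext x j
  simp [ModuleCat.hom_sum, Finset.sum_apply, Pi.single_apply]

theorem of_inAdd (h : InAdd T X) : FactorsThroughSum T X := by
  obtain ⟨n, N, ⟨e⟩⟩ := h
  obtain ⟨m, a, b, hab⟩ := of_pi T n
  let s : X ⟶ ModuleCat.of Γ (Fin n → T) :=
    ModuleCat.ofHom (e.toLinearMap ∘ₗ LinearMap.inl Γ X N)
  let r : ModuleCat.of Γ (Fin n → T) ⟶ X :=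
    ModuleCat.ofHom (LinearMap.fst Γ X N ∘ₗ e.symm.toLinearMap)
  refine ⟨m, fun i => s ≫ a i, fun i => b i ≫ r, ?_⟩
  have : s ≫ (∑ i, a i ≫ b i) ≫ r = 𝟙 X := by
    rw [hab]
    ext x
    simp [s, r]
  rw [← this]
  simp [Preadditive.sum_comp, Preadditive.comp_sum]

theorem generatedBy (h : FactorsThroughSum T X) : GeneratedBy T X := by
  obtain ⟨n, a, b, hab⟩ := h
  refine ⟨n, ∑ i, (b i).hom ∘ₗ LinearMap.proj i, fun x => ⟨fun i => (a i).hom x, ?_⟩⟩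
  have := congr(($hab).hom x)
  simpa [ModuleCat.hom_sum, LinearMap.sum_apply] using this

end Module

end FactorsThroughSum

/-! ### Modules generated by T -/

section Generation

variable {Γ : Type u} [Ring Γ] {T M N : ModuleCat.{u} Γ}

theorem GeneratedBy.of_fintype {ι : Type*} [Fintype ι] (f : (ι → T) →ₗ[Γ] M)
    (hf : Function.Surjective f) : GeneratedBy T M :=
  ⟨Fintype.card ι, f ∘ₗ (LinearEquiv.funCongrLeft Γ T (Fintype.equivFin ι)).toLinearMap,
    hf.comp (LinearEquiv.surjective _)⟩

theorem GeneratedBy.of_surjective (h : GeneratedBy T M) (f : M →ₗ[Γ] N)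
    (hf : Function.Surjective f) : GeneratedBy T N := by
  obtain ⟨m, g, hg⟩ := h
  exact ⟨m, f ∘ₗ g, hf.comp hg⟩

theorem GeneratedBy.pi (h : GeneratedBy T M) (n : ℕ) :
    GeneratedBy T (ModuleCat.of Γ (Fin n → M)) := by
  obtain ⟨m, g, hg⟩ := h
  refine .of_fintype (ι := Fin n × Fin m)
    ((g.compLeft (Fin n)) ∘ₗ (LinearEquiv.curry Γ T (Fin n) (Fin m)).toLinearMap) ?_
  rw [LinearMap.coe_comp]
  refine Function.Surjective.comp (fun x => ?_)
    (LinearEquiv.curry Γ T (Fin n) (Fin m)).surjective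
  choose y hy using fun i => hg (x i)
  exact ⟨y, funext hy⟩

theorem GeneratedBy.trans {Q : ModuleCat.{u} Γ} (h : GeneratedBy T M) (hT : GeneratedBy Q T) :
    GeneratedBy Q M := by
  obtain ⟨m, g, hg⟩ := h
  exact (hT.pi m).of_surjective (N := M) g hg

theorem GeneratedBy.finite (h : GeneratedBy T M) [Module.Finite Γ T] : Module.Finite Γ M := by
  obtain ⟨m, g, hg⟩ := h
  exact Module.Finite.of_surjective g hg

end Generation

/-! ### Vanishing of Ext¹, lifting and extension -/

section Homological

open Abelian

variable {C : Type*} [Category* C] [Abelian C] [HasExt.{u} C]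

/-- When pd X ≤ 1, Ext¹(X, -) is right exact: the obstruction to lifting a class lies in Ext² of X
with the kernel. -/
theorem ext_one_subsingleton_of_epi {X W Y : C} [HasProjectiveDimensionLT X 2]
    (hW : Subsingleton (Ext.{u} X W 1)) (p : W ⟶ Y) [Epi p] :
    Subsingleton (Ext.{u} X Y 1) := by
  refine subsingleton_of_forall_eq 0 fun e => ?_
  have hS : (ShortComplex.mk (Limits.kernel.ι p) p (by simp)).ShortExact :=
    { exact := ShortComplex.exact_kernel p }
  obtain ⟨x, hx⟩ := Ext.covariant_sequence_exact₃ X hS e (n₁ := 2) rfl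
    (Ext.eq_zero_of_hasProjectiveDimensionLT _ 2 le_rfl)
  rw [← hx, Subsingleton.elim x 0, Ext.zero_comp]

variable {S : ShortComplex C} (hS : S.ShortExact)

include hS

theorem CategoryTheory.ShortComplex.ShortExact.exists_lift {X : C}
    (hX : Subsingleton (Ext.{u} X S.X₁ 1)) (g : X ⟶ S.X₃) : ∃ h : X ⟶ S.X₂, h ≫ S.g = g := by
  obtain ⟨x, hx⟩ := Ext.covariant_sequence_exact₃ X hS (Ext.mk₀ g) (n₁ := 1) rfl
    (Subsingleton.elim _ _)
  obtain ⟨h, rfl⟩ := (Ext.mk₀_bijective X S.X₂).2 x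
  exact ⟨h, (Ext.mk₀_bijective X S.X₃).1 (by rw [← hx, Ext.mk₀_comp_mk₀])⟩

theorem CategoryTheory.ShortComplex.ShortExact.exists_extension {Y : C}
    (hY : Subsingleton (Ext.{u} S.X₃ Y 1)) (g : S.X₁ ⟶ Y) : ∃ h : S.X₂ ⟶ Y, S.f ≫ h = g := by
  obtain ⟨x, hx⟩ := Ext.contravariant_sequence_exact₁ hS Y (Ext.mk₀ g) (n₁ := 1) rfl
    (Subsingleton.elim _ _)
  obtain ⟨h, rfl⟩ := (Ext.mk₀_bijective S.X₂ Y).2 x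
  exact ⟨h, (Ext.mk₀_bijective S.X₁ Y).1 (by rw [← hx, Ext.mk₀_comp_mk₀])⟩

theorem CategoryTheory.ShortComplex.ShortExact.ext_one_subsingleton {X : C}
    (hX : Subsingleton (Ext.{u} X S.X₂ 1)) (hl : ∀ g : X ⟶ S.X₃, ∃ h : X ⟶ S.X₂, h ≫ S.g = g) :
    Subsingleton (Ext.{u} X S.X₁ 1) := by
  refine subsingleton_of_forall_eq 0 fun e => ?_
  obtain ⟨x, rfl⟩ := Ext.covariant_sequence_exact₁ X hS e (Subsingleton.elim _ _) (n₀ := 0) rfl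
  obtain ⟨g, rfl⟩ := (Ext.mk₀_bijective X S.X₃).2 x
  obtain ⟨h, rfl⟩ := hl g
  rw [← Ext.mk₀_comp_mk₀, Ext.comp_assoc (Ext.mk₀ h) (Ext.mk₀ S.g) hS.extClass (add_zero 0)
    (zero_add 1) (by omega), hS.comp_extClass, Ext.comp_zero]

end Homological

/-! ### The functor Hom(T, -) on add T -/

section HomFunctor

variable {C : Type*} [Category.{u} C] [Preadditive C] {T : C}

theorem projective_preadditiveCoyonedaObj_self (T : C) :
    Projective ((preadditiveCoyonedaObj T).obj T) := by
  let e : (End T)ᵐᵒᵖ ≃ₗ[(End T)ᵐᵒᵖ] ((preadditiveCoyonedaObj T).obj T) :=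
    { toFun := fun x => (x.unop : T ⟶ T)
      invFun := fun x => MulOpposite.op x
      left_inv := fun _ => rfl
      right_inv := fun _ => rfl
      map_add' := fun _ _ => rfl
      map_smul' := fun _ _ => rfl }
  have : Module.Projective (End T)ᵐᵒᵖ ((preadditiveCoyonedaObj T).obj T) :=
    Module.Projective.of_equiv e
  exact (IsProjective.iff_projective _).1 this

theorem FactorsThroughSum.projective_preadditiveCoyonedaObj {X : C} (h : FactorsThroughSum T X) :
    Projective ((preadditiveCoyonedaObj T).obj X) :=
  (h.map (preadditiveCoyonedaObj T)).projective (projective_preadditiveCoyonedaObj_self T)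

/-- Every x : T ⟶ X equals ∑ (x ≫ a i) ≫ b i, so the b i generate Hom(T, X) over `EndOp T`, and φ is
determined by its values on them. -/
theorem FactorsThroughSum.exists_preadditiveCoyonedaObj_map_eq {X Y : C}
    (h : FactorsThroughSum T X)
    (φ : (preadditiveCoyonedaObj T).obj X ⟶ (preadditiveCoyonedaObj T).obj Y) :
    ∃ f : X ⟶ Y, (preadditiveCoyonedaObj T).map f = φ := by
  obtain ⟨n, a, b, hab⟩ := h
  let b' : Fin n → (preadditiveCoyonedaObj T).obj X := b
  let c : Fin n → (T ⟶ Y) := fun i => φ.hom (b' i)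
  refine ⟨∑ i, a i ≫ c i, ?_⟩
  ext (x : T ⟶ X)
  let d : Fin n → (End T)ᵐᵒᵖ := fun i => MulOpposite.op (x ≫ a i)
  have hx : x = ∑ i, d i • b' i := by
    change x = ∑ i, (x ≫ a i) ≫ b i
    simp_rw [Category.assoc, ← Preadditive.comp_sum, hab, Category.comp_id]
  have h₁ : x ≫ ∑ i, a i ≫ c i = ∑ i, (x ≫ a i) ≫ c i := by
    simp_rw [Category.assoc, Preadditive.comp_sum]
  have h₂ : φ.hom (∑ i, d i • b' i) = ∑ i, d i • φ.hom (b' i) := by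
    simp_rw [map_sum, map_smul]
  exact h₁.trans (h₂.symm.trans (congrArg φ.hom hx.symm))

theorem preadditiveCoyonedaObj_map_shortExact {C : Type*} [Category.{u} C] [Abelian C] {T : C}
    {S : ShortComplex C} (hS : S.ShortExact)
    (hl : ∀ g : T ⟶ S.X₃, ∃ h : T ⟶ S.X₂, h ≫ S.g = g) :
    (S.map (preadditiveCoyonedaObj T)).ShortExact := by
  have := hS.mono_f
  refine ModuleCat.shortComplex_shortExact _ (fun (x : T ⟶ S.X₂) => ?_) ?_ hl
  · constructor
    · intro (h : x ≫ S.g = 0)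
      exact ⟨(hS.exact.lift x h : T ⟶ S.X₁), hS.exact.lift_f x h⟩
    · rintro ⟨(y : T ⟶ S.X₁), rfl⟩
      change (y ≫ S.f) ≫ S.g = 0
      simp
  · intro (x : T ⟶ S.X₁) (y : T ⟶ S.X₁) (h : x ≫ S.f = y ≫ S.f)
    exact (cancel_mono S.f).1 h

end HomFunctor

/-! ### Finitely generated submodules of Hom(T, X) -/

section Free

variable {Γ : Type u} [Ring Γ]

/-- `Hom(T, T ^ n)` is free of rank `n` over `End(T)ᵒᵖ`. -/
noncomputable def homModulePiEquiv (T : ModuleCat.{u} Γ) (n : ℕ) :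
    (Fin n → EndOp T) ≃ₗ[EndOp T] homModule T (ModuleCat.of Γ (Fin n → T)) where
  toFun c := (ModuleCat.ofHom (LinearMap.pi fun i => ((c i).unop : T ⟶ T).hom) :
    T ⟶ ModuleCat.of Γ (Fin n → T))
  invFun k i := MulOpposite.op
    ((k : T ⟶ ModuleCat.of Γ (Fin n → T)) ≫ ModuleCat.ofHom (LinearMap.proj i) : T ⟶ T)
  left_inv _ := rfl
  right_inv _ := rfl
  map_add' _ _ := rfl
  map_smul' _ _ := rfl

/-- Generators of S give a linear map from the free module Hom(T, Tⁿ), which fullness realizes by a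
Γ-linear map. This yields approximations and presentations. -/
theorem exists_homModule_map_range_eq {T X : ModuleCat.{u} Γ}
    (S : Submodule (EndOp T) (homModule T X)) (hS : S.FG) :
    ∃ (n : ℕ) (h : ModuleCat.of Γ (Fin n → T) ⟶ X),
      ∀ g : T ⟶ X, (∃ k : T ⟶ ModuleCat.of Γ (Fin n → T), k ≫ h = g) ↔
        (g : homModule T X) ∈ S := by
  have : Module.Finite (EndOp T) S := Module.Finite.iff_fg.2 hS
  obtain ⟨n, q, hq⟩ := Module.Finite.exists_fin' (EndOp T) S
  obtain ⟨h, hh⟩ := (FactorsThroughSum.of_pi T n).exists_preadditiveCoyonedaObj_map_eq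
    (ModuleCat.ofHom (S.subtype ∘ₗ q ∘ₗ (homModulePiEquiv T n).symm.toLinearMap))
  refine ⟨n, h, fun g => ⟨?_, fun hg => ?_⟩⟩
  · rintro ⟨k, rfl⟩
    have hk := congr(($hh).hom k)
    exact Eq.mpr (congrArg (· ∈ S) hk) (q ((homModulePiEquiv T n).symm k)).2
  · obtain ⟨c, hc⟩ := hq ⟨g, hg⟩
    have hk := congr(($hh).hom (homModulePiEquiv T n c))
    refine ⟨homModulePiEquiv T n c, hk.trans ?_⟩
    change ((q ((homModulePiEquiv T n).symm (homModulePiEquiv T n c)) : S) : homModule T X) = _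
    rw [LinearEquiv.symm_apply_apply, hc]

end Free

/-! ### Noetherian Hom modules over an artin algebra -/

section ArtinAlgebra

variable (R : Type*) [CommRing R] [IsArtinianRing R] {Γ : Type u} [Ring Γ] [Algebra R Γ]
  [Module.Finite R Γ]

include R in
theorem isNoetherianRing_of_finite_artinian : IsNoetherianRing Γ :=
  have : IsNoetherian R Γ := inferInstance
  isNoetherian_of_tower R this

include R in
/-- Over an artin algebra, homomorphism spaces between finitely generated modules are noetherian
over the endomorphism ring. -/
theorem isNoetherian_homModule (T M : ModuleCat.{u} Γ) [Module.Finite Γ T] [Module.Finite Γ M] :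
    IsNoetherian (EndOp T) (homModule T M) := by
  let := Module.compHom T (algebraMap R Γ)
  let := Module.compHom M (algebraMap R Γ)
  have : IsScalarTower R Γ T :=
    ⟨fun r γ x => by rw [Algebra.smul_def, mul_smul]; rfl⟩
  have : IsScalarTower R Γ M :=
    ⟨fun r γ x => by rw [Algebra.smul_def, mul_smul]; rfl⟩
  have : Module.Finite R M := Module.Finite.trans Γ M
  have hsT : ∀ (r : R) (γ : Γ) (x : T), r • γ • x = γ • r • x := fun r γ x => by
    rw [← algebraMap_smul Γ r (γ • x), ← algebraMap_smul Γ r x, ← mul_smul, ← mul_smul,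
      Algebra.commutes]
  have hsM : ∀ (r : R) (γ : Γ) (x : M), r • γ • x = γ • r • x := fun r γ x => by
    rw [← algebraMap_smul Γ r (γ • x), ← algebraMap_smul Γ r x, ← mul_smul, ← mul_smul,
      Algebra.commutes]
  have : SMulCommClass Γ R M := ⟨fun γ r x => (hsM r γ x).symm⟩
  obtain ⟨n, p, hp⟩ := Module.Finite.exists_fin' Γ T
  let sR : R → EndOp T := fun r => MulOpposite.op (ModuleCat.ofHom
    { toFun := fun x => r • x
      map_add' := smul_add r
      map_smul' := fun γ x => hsT r γ x } : T ⟶ T)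
  -- Evaluation on generators of T embeds Hom(T, M) in Mⁿ. Scalars of R act through `sR`, so
  -- submodules become R-submodules of a noetherian R-module.
  let ev : homModule T M →+ (Fin n → M) :=
    { toFun := fun (f : T ⟶ M) i => f.hom (p (Pi.single i 1))
      map_zero' := rfl
      map_add' := fun _ _ => rfl }
  have hev : Function.Injective ev := fun (f : T ⟶ M) (g : T ⟶ M) h => by
    have : f.hom ∘ₗ p = g.hom ∘ₗ p := by
      ext i
      have hi : f.hom (p (Pi.single i 1)) = g.hom (p (Pi.single i 1)) := congrFun h i
      simpa using hi
    refine ModuleCat.hom_ext (LinearMap.ext fun x => ?_)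
    obtain ⟨y, rfl⟩ := hp x
    exact congr($this y)
  have hsmul : ∀ (r : R) (f : homModule T M), ev (sR r • f) = r • ev f := fun r (f : T ⟶ M) => by
    funext i
    change f.hom (r • p (Pi.single i 1)) = r • f.hom (p (Pi.single i 1))
    rw [← algebraMap_smul Γ r (p _), map_smul, algebraMap_smul]
  let Φ : Submodule (EndOp T) (homModule T M) → Submodule R (Fin n → M) := fun S =>
    { carrier := ev '' S
      zero_mem' := ⟨0, S.zero_mem, map_zero ev⟩
      add_mem' := by
        rintro _ _ ⟨x, hx, rfl⟩ ⟨y, hy, rfl⟩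
        exact ⟨x + y, S.add_mem hx hy, map_add ev x y⟩
      smul_mem' := by
        rintro r _ ⟨x, hx, rfl⟩
        exact ⟨sR r • x, S.smul_mem _ hx, hsmul r x⟩ }
  have hΦ : StrictMono Φ := by
    refine Monotone.strictMono_of_injective (fun S S' h => Set.image_mono h) fun S S' h => ?_
    exact SetLike.coe_injective (hev.image_injective congr(($h : Set (Fin n → M))))
  exact isNoetherian_mk hΦ.wellFoundedGT

end ArtinAlgebra

/-! ### The torsion class Gen T and its approximations -/

section Tilting

open Abelian

variable {Γ : Type u} [Ring Γ] {T : ModuleCat.{u} Γ}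

theorem GeneratedBy.ext_one_subsingleton {M X : ModuleCat.{u} Γ} (h : GeneratedBy T M)
    [HasProjectiveDimensionLT X 2] (hext : Subsingleton (Ext X T 1)) :
    Subsingleton (Ext X M 1) := by
  obtain ⟨m, p, hp⟩ := h
  have : Epi (ModuleCat.ofHom p) := (ModuleCat.epi_iff_surjective _).2 hp
  exact ext_one_subsingleton_of_epi ((FactorsThroughSum.of_pi T m).ext_right hext)
    (ModuleCat.ofHom p)

theorem IsTiltingModule.hasProjectiveDimensionLT (hT : IsTiltingModule T) :
    HasProjectiveDimensionLT T 2 :=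
  (projectiveDimension_le_iff T 1).1 hT.projectiveDimension_le

theorem IsTiltingModule.ext_one_of_generatedBy (hT : IsTiltingModule T) {M : ModuleCat.{u} Γ}
    (h : GeneratedBy T M) : Subsingleton (Ext T M 1) :=
  have := hT.hasProjectiveDimensionLT
  h.ext_one_subsingleton hT.ext_subsingleton

/-- As Ext¹(T₁, K) = 0, each map Γ → K extends along Γ → T₀; a finite generating set of K is thus
reached from copies of T₀. -/
theorem IsTiltingModule.generatedBy_of_ext_one (hT : IsTiltingModule T) {K : ModuleCat.{u} Γ}
    [Module.Finite Γ K] (h : Subsingleton (Ext T K 1)) : GeneratedBy T K := by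
  obtain ⟨T₀, T₁, f, g, h₀, h₁, hf, hfg, hg⟩ := hT.exists_coresolution
  have hS : (ShortComplex.mk (ModuleCat.ofHom f) (ModuleCat.ofHom g)
      (ModuleCat.hom_ext (LinearMap.ext hfg.apply_apply_eq_zero))).ShortExact :=
    ModuleCat.shortComplex_shortExact _ hfg hf hg
  obtain ⟨n, p, hp⟩ := Module.Finite.exists_fin' Γ K
  have hext : Subsingleton (Ext T₁ K 1) := (FactorsThroughSum.of_inAdd h₁).ext_left h
  choose k hk using fun i : Fin n => hS.exists_extension hext
    (ModuleCat.ofHom (p ∘ₗ LinearMap.single Γ (fun _ : Fin n => Γ) i))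
  refine ((FactorsThroughSum.of_inAdd h₀).generatedBy.pi n).of_surjective
    (∑ i, (k i).hom ∘ₗ LinearMap.proj i) fun x => ?_
  obtain ⟨y, rfl⟩ := hp x
  refine ⟨fun i => f (y i), ?_⟩
  have hk' : ∀ i, (k i).hom (f (y i)) = p (Pi.single i (y i)) := fun i =>
    congr(($(hk i)).hom (y i))
  rw [LinearMap.sum_apply]
  change ∑ i, (k i).hom (f (y i)) = p y
  simp_rw [hk', ← map_sum, Finset.univ_sum_single]

/-- A short exact sequence `0 → K → T ^ n → M → 0` which remains exact under `Hom(T, -)`. -/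
theorem IsTiltingModule.exists_approximation (hT : IsTiltingModule T) [IsNoetherianRing Γ]
    {M : ModuleCat.{u} Γ} (hM : GeneratedBy T M)
    (hfin : Module.Finite (EndOp T) (homModule T M)) :
    ∃ S : ShortComplex (ModuleCat.{u} Γ), S.ShortExact ∧ S.X₃ = M ∧ FactorsThroughSum T S.X₂ ∧
      GeneratedBy T S.X₁ ∧ ∀ g : T ⟶ S.X₃, ∃ h : T ⟶ S.X₂, h ≫ S.g = g := by
  have := hT.finite
  obtain ⟨n, p, hp'⟩ := exists_homModule_map_range_eq (⊤ : Submodule (EndOp T) (homModule T M))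
    Module.Finite.fg_top
  have hlift : ∀ k : T ⟶ M, ∃ h : T ⟶ ModuleCat.of Γ (Fin n → T), h ≫ p = k :=
    fun k => (hp' k).2 trivial
  have hp : Function.Surjective p.hom := by
    obtain ⟨m, r, hr⟩ := hM
    rw [← LinearMap.range_eq_top, eq_top_iff, ← LinearMap.range_eq_top.2 hr]
    rintro _ ⟨y, rfl⟩
    rw [← Finset.univ_sum_single y, map_sum]
    refine Submodule.sum_mem _ fun i _ => ?_
    obtain ⟨h, hh⟩ := hlift (ModuleCat.ofHom
      (r ∘ₗ LinearMap.single Γ (fun _ : Fin m => (T : Type u)) i))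
    exact ⟨h.hom (y i), congr(($hh).hom (y i))⟩
  have hS := LinearMap.shortExact_shortComplexKer hp
  refine ⟨_, hS, rfl, .of_pi T n, ?_, hlift⟩
  have : Module.Finite Γ (LinearMap.ker p.hom) := inferInstance
  exact hT.generatedBy_of_ext_one (K := ModuleCat.of Γ (LinearMap.ker p.hom))
    (hS.ext_one_subsingleton ((FactorsThroughSum.of_pi T n).ext_right hT.ext_subsingleton) hlift)

end Tilting

/-! ### Comparison of pd M with pd Hom(T, M) -/

section Dimension

open Abelian

variable {Γ : Type u} [Ring Γ] {T : ModuleCat.{u} Γ}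

theorem GeneratedBy.hom_eq {X Y : ModuleCat.{u} Γ} (h : GeneratedBy T X) {a b : X ⟶ Y}
    (hab : ∀ g : T ⟶ X, g ≫ a = g ≫ b) : a = b := by
  obtain ⟨m, p, hp⟩ := h
  have : a.hom ∘ₗ p = b.hom ∘ₗ p := LinearMap.pi_ext' fun i =>
    congr(($(hab (ModuleCat.ofHom (p ∘ₗ LinearMap.single Γ (fun _ : Fin m => (T : Type u)) i)))).hom)
  refine ModuleCat.hom_ext (LinearMap.ext fun x => ?_)
  obtain ⟨y, rfl⟩ := hp x
  exact congr($this y)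

theorem ext_one_subsingleton_of_generatedBy_injective {Q X M : ModuleCat.{u} Γ} [Injective Q]
    (h : GeneratedBy Q M) [HasProjectiveDimensionLT X 2] : Subsingleton (Ext X M 1) :=
  h.ext_one_subsingleton (subsingleton_of_forall_eq 0 fun e => e.eq_zero_of_injective)

variable (hT : IsTiltingModule T) [IsNoetherianRing Γ]
  (hfin : ∀ M : ModuleCat.{u} Γ, Module.Finite Γ M → Module.Finite (EndOp T) (homModule T M))

include hT hfin

theorem IsTiltingModule.hasProjectiveDimensionLT_homModule {Q : ModuleCat.{u} Γ} [Injective Q]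
    (hQ : GeneratedBy Q T) (k : ℕ) :
    ∀ M : ModuleCat.{u} Γ, GeneratedBy T M → HasProjectiveDimensionLT M (k + 2) →
      HasProjectiveDimensionLT (homModule T M) (k + 1) := by
  have := hT.finite
  have := hT.hasProjectiveDimensionLT
  induction k with
  | zero =>
    intro M hM hpd
    obtain ⟨S, hS, rfl, h₂, h₁, -⟩ := hT.exists_approximation hM (hfin M hM.finite)
    have := hpd
    -- The kernel lies in Gen T, hence in Gen Q, so pd M ≤ 1 forces Ext¹(M, K) = 0 and the sequence
    -- splits.
    obtain ⟨s, hs⟩ := hS.exists_lift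
      (ext_one_subsingleton_of_generatedBy_injective (X := S.X₃) (h₁.trans hQ)) (𝟙 _)
    have r : Retract S.X₃ S.X₂ := ⟨s, S.g, hs⟩
    have := h₂.projective_preadditiveCoyonedaObj
    exact (r.map (preadditiveCoyonedaObj T)).hasProjectiveDimensionLT 1
  | succ k ih =>
    intro M hM hpd
    obtain ⟨S, hS, rfl, h₂, h₁, hl⟩ := hT.exists_approximation hM (hfin M hM.finite)
    have h₂' := h₂.hasProjectiveDimensionLT 2 this
    have := h₂.projective_preadditiveCoyonedaObj
    exact (preadditiveCoyonedaObj_map_shortExact hS hl).hasProjectiveDimensionLT_X₃ (k + 1)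
      (ih _ h₁ (hS.hasProjectiveDimensionLT_X₁ (k + 2)
        (hasProjectiveDimensionLT_of_ge _ 2 _ (by omega)) hpd))
      (hasProjectiveDimensionLT_of_ge ((preadditiveCoyonedaObj T).obj S.X₂) 1 _ (by omega))

theorem IsTiltingModule.hasProjectiveDimensionLT_of_homModule (k : ℕ) :
    ∀ M : ModuleCat.{u} Γ, GeneratedBy T M → HasProjectiveDimensionLT (homModule T M) (k + 1) →
      HasProjectiveDimensionLT M (k + 2) := by
  have := hT.finite
  have := hT.hasProjectiveDimensionLT
  induction k with
  | zero =>
    intro M hM hpd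
    obtain ⟨S, hS, rfl, h₂, h₁, hl⟩ := hT.exists_approximation hM (hfin M hM.finite)
    have hS' := preadditiveCoyonedaObj_map_shortExact hS hl
    have : Projective (S.map (preadditiveCoyonedaObj T)).X₃ :=
      projective_iff_hasProjectiveDimensionLT_one.2 hpd
    -- The splitting of the Hom sequence descends: fullness on add T gives `ρ`, and faithfulness on
    -- Gen T makes it a retraction.
    let σ := hS'.splittingOfProjective
    obtain ⟨ρ, hρ⟩ := h₂.exists_preadditiveCoyonedaObj_map_eq σ.r
    have hfρ : S.f ≫ ρ = 𝟙 _ := h₁.hom_eq fun g => by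
      have : (preadditiveCoyonedaObj T).map S.f ≫ (preadditiveCoyonedaObj T).map ρ = 𝟙 _ := by
        rw [hρ]; exact σ.f_r
      have h := congr(($this).hom g)
      rw [Category.comp_id, ← Category.assoc]
      exact h
    let τ := ShortComplex.Splitting.ofExactOfRetraction S hS.exact ρ hfρ hS.epi_g
    have h₂' := h₂.hasProjectiveDimensionLT 2 ‹_›
    have r : Retract S.X₃ S.X₂ := ⟨τ.s, S.g, τ.s_g⟩
    exact r.hasProjectiveDimensionLT 2
  | succ k ih =>
    intro M hM hpd
    obtain ⟨S, hS, rfl, h₂, h₁, hl⟩ := hT.exists_approximation hM (hfin M hM.finite)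
    have h₂' := h₂.hasProjectiveDimensionLT 2 this
    have := h₂.projective_preadditiveCoyonedaObj
    exact hS.hasProjectiveDimensionLT_X₃ (k + 2)
      (ih _ h₁ ((preadditiveCoyonedaObj_map_shortExact hS hl).hasProjectiveDimensionLT_X₁ (k + 1)
        (hasProjectiveDimensionLT_of_ge ((preadditiveCoyonedaObj T).obj S.X₂) 1 _ (by omega))
        hpd))
      (hasProjectiveDimensionLT_of_ge _ 2 _ (by omega))

end Dimension

/-! ### Syzygies over End(T)ᵒᵖ and embeddings into Gen T -/

section Presentations

open Abelian

variable {Γ : Type u} [Ring Γ] {T : ModuleCat.{u} Γ}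

/-- Every finitely generated module over the endomorphism ring of a tilting module has a syzygy of
the form `Hom(T, M)` with `M` generated by `T`. -/
theorem IsTiltingModule.exists_syzygy_eq_homModule (hT : IsTiltingModule T)
    (hnoeth : ∀ M : ModuleCat.{u} Γ, Module.Finite Γ M → IsNoetherian (EndOp T) (homModule T M))
    (N : ModuleCat.{u} (EndOp T)) [Module.Finite (EndOp T) N] :
    ∃ (m : ℕ) (M : ModuleCat.{u} Γ) (j : M ⟶ ModuleCat.of Γ (Fin m → T))
      (π : homModule T (ModuleCat.of Γ (Fin m → T)) ⟶ N)
      (w : (preadditiveCoyonedaObj T).map j ≫ π = 0),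
      GeneratedBy T M ∧ (ShortComplex.mk _ _ w).ShortExact := by
  have := hT.finite
  have hfin (n : ℕ) : IsNoetherian (EndOp T) (homModule T (ModuleCat.of Γ (Fin n → T))) :=
    hnoeth (ModuleCat.of Γ (Fin n → T)) (inferInstanceAs (Module.Finite Γ (Fin n → T)))
  obtain ⟨m, p, hp⟩ := Module.Finite.exists_fin' (EndOp T) N
  let π : homModule T (ModuleCat.of Γ (Fin m → T)) →ₗ[EndOp T] N :=
    p ∘ₗ (homModulePiEquiv T m).symm.toLinearMap
  have hπ : Function.Surjective π := by
    rw [LinearMap.coe_comp]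
    exact hp.comp (homModulePiEquiv T m).symm.surjective
  obtain ⟨n, f, hf⟩ := exists_homModule_map_range_eq (LinearMap.ker π) (IsNoetherian.noetherian _)
  obtain ⟨l, h, hh⟩ := exists_homModule_map_range_eq
    (LinearMap.ker ((preadditiveCoyonedaObj T).map f).hom) (IsNoetherian.noetherian _)
  have hh' : ∀ g : T ⟶ ModuleCat.of Γ (Fin n → T), (∃ k, k ≫ h = g) ↔ g ≫ f = 0 := hh
  have hhf : h ≫ f = 0 := (FactorsThroughSum.of_pi T l).generatedBy.hom_eq fun g => by
    rw [← Category.assoc, (hh' _).1 ⟨g, rfl⟩, Limits.comp_zero]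
  let L := LinearMap.range h.hom
  -- The range of h is the trace of T in ker f. Dividing by it alone need not make j injective, but
  -- does make Hom(T, j) injective.
  let M := ModuleCat.of Γ ((Fin n → T) ⧸ L)
  let c : ModuleCat.of Γ (Fin n → T) ⟶ M := ModuleCat.ofHom L.mkQ
  let j : M ⟶ ModuleCat.of Γ (Fin m → T) := ModuleCat.ofHom (L.liftQ f.hom (by
    rintro _ ⟨x, rfl⟩
    exact congr(($hhf).hom x)))
  have hcj : c ≫ j = f := rfl
  have hhc : h ≫ c = 0 := ModuleCat.hom_ext (LinearMap.ext fun x =>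
    (Submodule.Quotient.mk_eq_zero L).2 ⟨x, rfl⟩)
  have hL : GeneratedBy T (ModuleCat.of Γ L) :=
    (FactorsThroughSum.of_pi T l).generatedBy.of_surjective h.hom.rangeRestrict
      h.hom.surjective_rangeRestrict
  have hS : (ShortComplex.mk (ModuleCat.ofHom L.subtype) c
      (ModuleCat.hom_ext (LinearMap.ext fun x => (Submodule.Quotient.mk_eq_zero L).2 x.2))).ShortExact :=
    ModuleCat.shortComplex_shortExact _ (LinearMap.exact_subtype_mkQ L) L.injective_subtype
      L.mkQ_surjective
  -- L lies in Gen T, so Ext¹(T, L) = 0; elements of Hom(T, M) can then be handled through Tⁿ.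
  have hlift (g : T ⟶ M) : ∃ k, k ≫ c = g := hS.exists_lift (hT.ext_one_of_generatedBy hL) g
  refine ⟨m, M, j, ModuleCat.ofHom π, ?_,
    (FactorsThroughSum.of_pi T n).generatedBy.of_surjective c.hom L.mkQ_surjective, ?_⟩
  · refine ModuleCat.hom_ext (LinearMap.ext fun (x : T ⟶ M) => ?_)
    obtain ⟨k, rfl⟩ := hlift x
    exact (hf ((k ≫ c) ≫ j)).1 ⟨k, by rw [Category.assoc, hcj]⟩
  · refine ModuleCat.shortComplex_shortExact _ (fun (x : T ⟶ _) => ⟨fun hx => ?_, ?_⟩) ?_ hπ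
    · obtain ⟨k, hk⟩ := (hf x).2 hx
      exact ⟨(k ≫ c : T ⟶ M), (Category.assoc k c j).trans hk⟩
    · rintro ⟨(x : T ⟶ M), rfl⟩
      obtain ⟨k, rfl⟩ := hlift x
      exact (hf ((k ≫ c) ≫ j)).1 ⟨k, by rw [Category.assoc, hcj]⟩
    · refine (injective_iff_map_eq_zero _).2 fun (x : T ⟶ M) (hx : x ≫ j = 0) => ?_
      obtain ⟨k, rfl⟩ := hlift x
      rw [Category.assoc, hcj] at hx
      obtain ⟨z, rfl⟩ := (hh' k).2 hx
      change (z ≫ h) ≫ c = 0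
      rw [Category.assoc, hhc, Limits.comp_zero]

/-- Every finitely generated module embeds into a module generated by the tilting module `T`, with
cokernel of projective dimension at most one. -/
theorem IsTiltingModule.exists_coresolution_of_finite (hT : IsTiltingModule T)
    (X : ModuleCat.{u} Γ) [Module.Finite Γ X] :
    ∃ S : ShortComplex (ModuleCat.{u} Γ), S.ShortExact ∧ S.X₁ = X ∧ GeneratedBy T S.X₂ ∧
      HasProjectiveDimensionLT S.X₃ 2 := by
  obtain ⟨T₀, T₁, f, g, h₀, h₁, hf, hfg, hg⟩ := hT.exists_coresolution
  obtain ⟨n, p, hp⟩ := Module.Finite.exists_fin' Γ X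
  let F : (Fin n → Γ) →ₗ[Γ] (Fin n → T₀) := f.compLeft (Fin n)
  let G : (Fin n → T₀) →ₗ[Γ] (Fin n → T₁) := g.compLeft (Fin n)
  have hF : Function.Injective F := fun x y h => funext fun i => hf (congrFun h i)
  have hG : Function.Surjective G := fun x => by
    choose y hy using fun i => hg (x i)
    exact ⟨y, funext hy⟩
  have hFG (x) : G x = 0 ↔ ∃ y, F y = x := by
    refine ⟨fun h => ?_, ?_⟩
    · choose y hy using fun i => (hfg (x i)).1 (congrFun h i)
      exact ⟨y, funext hy⟩
    · rintro ⟨y, rfl⟩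
      exact funext fun i => hfg.apply_apply_eq_zero (y i)
  -- Dividing the n-fold coresolution by the relations K of X leaves the cokernel T₁ⁿ unchanged.
  let K := LinearMap.ker p
  let K' := K.map F
  let α : ((Fin n → Γ) ⧸ K) →ₗ[Γ] ((Fin n → T₀) ⧸ K') := K.mapQ K' F (K.le_comap_map F)
  let e : ((Fin n → Γ) ⧸ K) ≃ₗ[Γ] X := p.quotKerEquivOfSurjective hp
  let β : ((Fin n → T₀) ⧸ K') →ₗ[Γ] (Fin n → T₁) := K'.liftQ G (by
    rintro _ ⟨x, -, rfl⟩
    exact (hFG _).2 ⟨x, rfl⟩)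
  have hα : Function.Injective α := by
    refine (injective_iff_map_eq_zero _).2 fun x hx => ?_
    obtain ⟨x, rfl⟩ := K.mkQ_surjective x
    obtain ⟨y, hy, hyx⟩ := (Submodule.Quotient.mk_eq_zero K').1 hx
    exact (Submodule.Quotient.mk_eq_zero K).2 (hF hyx ▸ hy)
  have hαβ (x) : β x = 0 ↔ ∃ y, α y = x := by
    refine ⟨fun h => ?_, ?_⟩
    · obtain ⟨x, rfl⟩ := K'.mkQ_surjective x
      obtain ⟨y, rfl⟩ := (hFG x).1 h
      exact ⟨K.mkQ y, rfl⟩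
    · rintro ⟨y, rfl⟩
      obtain ⟨y, rfl⟩ := K.mkQ_surjective y
      exact (hFG (F y)).2 ⟨y, rfl⟩
  let S : ShortComplex (ModuleCat.{u} Γ) :=
    { X₁ := X
      X₂ := ModuleCat.of Γ ((Fin n → T₀) ⧸ K')
      X₃ := ModuleCat.of Γ (Fin n → T₁)
      f := ModuleCat.ofHom (α ∘ₗ e.symm.toLinearMap)
      g := ModuleCat.ofHom β
      zero := ModuleCat.hom_ext (LinearMap.ext fun x => (hαβ _).2 ⟨e.symm x, rfl⟩) }
  refine ⟨S, ModuleCat.shortComplex_shortExact S (fun x => (hαβ x).trans ?_)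
    (hα.comp e.symm.injective) (fun x => ?_), rfl, ?_, ?_⟩
  · constructor
    · rintro ⟨y, rfl⟩
      exact ⟨e y, congrArg α (e.symm_apply_apply y)⟩
    · rintro ⟨y, rfl⟩
      exact ⟨e.symm y, rfl⟩
  · obtain ⟨y, rfl⟩ := hG x
    exact ⟨K'.mkQ y, rfl⟩
  · exact ((FactorsThroughSum.of_inAdd h₀).generatedBy.pi n).of_surjective
      (M := ModuleCat.of Γ (Fin n → T₀)) K'.mkQ K'.mkQ_surjective
  · exact (FactorsThroughSum.of_pi T₁ n).hasProjectiveDimensionLT 2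
      ((FactorsThroughSum.of_inAdd h₁).hasProjectiveDimensionLT 2 hT.hasProjectiveDimensionLT)

end Presentations

/-! ### Arithmetic of extended dimensions -/

theorem WithBot.eq_or_add_one_eq_of_le_of_le {x y : WithBot ℕ∞} (h : x ≤ y) (h' : y ≤ x + 1) :
    x = y ∨ x + 1 = y := by
  induction x using WithBot.recBotCoe with
  | bot => exact Or.inl (le_antisymm h h')
  | coe x =>
    induction y using WithBot.recBotCoe with
    | bot => exact absurd h (by simp)
    | coe y =>
      norm_cast at h h' ⊢
      rcases h.eq_or_lt with h | h
      · exact Or.inl h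
      · exact Or.inr (le_antisymm (Order.add_one_le_of_lt h) h')

/-- The bound 1 ≤ y matters at k = 0, where it rules out x = ⊥. -/
theorem WithBot.add_one_eq_of_forall_lt_iff {x y : WithBot ℕ∞} (hy : 1 ≤ y)
    (h : ∀ k : ℕ, x < k ↔ y < (k + 1 : ℕ)) : x + 1 = y := by
  induction x using WithBot.recBotCoe with
  | bot => exact absurd hy (not_le.2 (by simpa using h 0))
  | coe x =>
    induction y using WithBot.recBotCoe with
    | bot => exact absurd hy (by simp)
    | coe y =>
      have h' (k : ℕ) : x < k ↔ y < (k + 1 : ℕ) := by exact_mod_cast h k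
      have hy' : 1 ≤ y := by exact_mod_cast hy
      norm_cast
      induction y using ENat.recTopCoe with
      | top =>
        induction x using ENat.recTopCoe with
        | top => rfl
        | coe x => exact absurd ((h' (x + 1)).1 (by exact_mod_cast x.lt_succ_self)) (by simp)
      | coe y =>
        obtain ⟨z, rfl⟩ : ∃ z, y = z + 1 :=
          Nat.exists_eq_add_of_le' (by exact_mod_cast hy')
        have h₁ := (h' (z + 1)).2 (by exact_mod_cast (z + 1).lt_succ_self)
        have h₂ : ¬ x < z := fun h => by simpa using (h' z).1 h
        lift x to ℕ using ne_top_of_lt h₁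
        norm_cast at h₁ h₂ ⊢
        omega

/-! ### Projective and global dimensions -/

section GlobalDimension

variable {Γ : Type u} [Ring Γ]

theorem globalDimension_le_iff {d : WithBot ℕ∞} :
    globalDimension Γ ≤ d ↔
      ∀ M : ModuleCat.{u} Γ, Module.Finite Γ M → projectiveDimension M ≤ d :=
  iSup₂_le_iff

theorem IsProjInjSum.injective {Q : ModuleCat.{u} Γ} (h : IsProjInjSum Q) : Injective Q := by
  obtain ⟨t, P, hP, -, -, ⟨e⟩⟩ := h
  have : Injective (ModuleCat.of Γ ((i : Fin t) → P i)) := ⟨fun {X Y} g f _ => by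
    have (i : Fin t) : Injective (P i) := (hP i).injective
    refine ⟨ModuleCat.ofHom (LinearMap.pi fun i =>
      (Injective.factorThru (g ≫ ModuleCat.ofHom (LinearMap.proj i)) f).hom), ?_⟩
    refine ModuleCat.hom_ext (LinearMap.ext fun x => funext fun i => ?_)
    exact congr(($(Injective.comp_factorThru
      (g ≫ ModuleCat.ofHom (LinearMap.proj (φ := fun i => (P i : Type u)) i)) f)).hom x)⟩
  exact Injective.of_iso (LinearEquiv.toModuleIso e).symm this

theorem GeneratedBy.isZero_of_isZero_homModule {T M : ModuleCat.{u} Γ} (h : GeneratedBy T M)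
    (h₀ : Limits.IsZero (homModule T M)) : Limits.IsZero M := by
  have := ModuleCat.subsingleton_of_isZero h₀
  rw [Limits.IsZero.iff_id_eq_zero]
  exact h.hom_eq fun g => Subsingleton.elim (α := homModule T M) _ _

/-- If the finitely generated modules are projective, every map between them is von Neumann
regular. -/
theorem exists_comp_comp_eq_self_of_forall_projective
    (h : ∀ M : ModuleCat.{u} Γ, Module.Finite Γ M → Projective M) {M N : ModuleCat.{u} Γ}
    [Module.Finite Γ M] [Module.Finite Γ N] (j : M ⟶ N) : ∃ r : N ⟶ M, j ≫ r ≫ j = j := by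
  let L := LinearMap.range j.hom
  have h₁ : Module.Projective Γ L :=
    (IsProjective.iff_projective _).2 (h (ModuleCat.of Γ L) (inferInstanceAs (Module.Finite Γ L)))
  have h₂ : Module.Projective Γ (N ⧸ L) :=
    (IsProjective.iff_projective _).2
      (h (ModuleCat.of Γ (N ⧸ L)) (inferInstanceAs (Module.Finite Γ (N ⧸ L))))
  obtain ⟨t, ht⟩ := Module.projective_lifting_property j.hom.rangeRestrict LinearMap.id
    j.hom.surjective_rangeRestrict
  obtain ⟨s, hs⟩ := Module.projective_lifting_property L.mkQ LinearMap.id L.mkQ_surjective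
  let ρ : N →ₗ[Γ] L := (LinearMap.id - s ∘ₗ L.mkQ).codRestrict L fun x => by
    rw [← Submodule.Quotient.mk_eq_zero, ← Submodule.mkQ_apply, LinearMap.sub_apply, map_sub,
      sub_eq_zero]
    exact congr($hs (L.mkQ x)).symm
  refine ⟨ModuleCat.ofHom (t ∘ₗ ρ), ModuleCat.hom_ext (LinearMap.ext fun x => ?_)⟩
  have h₃ : j.hom (t (ρ (j.hom x))) = ρ (j.hom x) := congr((($ht (ρ (j.hom x)) : L) : N))
  have h₄ : L.mkQ (j.hom x) = 0 := (Submodule.Quotient.mk_eq_zero L).2 ⟨x, rfl⟩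
  refine h₃.trans ?_
  change j.hom x - s (L.mkQ (j.hom x)) = j.hom x
  rw [h₄, map_zero, sub_zero]

variable {T : ModuleCat.{u} Γ} (hT : IsTiltingModule T) [IsNoetherianRing Γ]
  (hnoeth : ∀ M : ModuleCat.{u} Γ, Module.Finite Γ M → IsNoetherian (EndOp T) (homModule T M))

include hT hnoeth

theorem IsTiltingModule.projectiveDimension_homModule_add_one {Q : ModuleCat.{u} Γ} [Injective Q]
    (hQ : GeneratedBy Q T) {M : ModuleCat.{u} Γ} (hM : GeneratedBy T M)
    (hpd : 1 ≤ projectiveDimension M) :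
    projectiveDimension (homModule T M) + 1 = projectiveDimension M := by
  have hfin (M : ModuleCat.{u} Γ) (h : Module.Finite Γ M) :
      Module.Finite (EndOp T) (homModule T M) :=
    have := hnoeth M h
    inferInstance
  refine WithBot.add_one_eq_of_forall_lt_iff hpd fun k => ?_
  rw [projectiveDimension_lt_iff, projectiveDimension_lt_iff]
  match k with
  | 0 =>
    have h₁ : ¬ HasProjectiveDimensionLT M 1 := (projectiveDimension_ge_iff M 1).1 hpd
    refine ⟨fun h => ?_, fun h => absurd h h₁⟩
    have := (hM.isZero_of_isZero_homModule
      (isZero_of_hasProjectiveDimensionLT_zero _)).hasProjectiveDimensionLT_zero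
    exact hasProjectiveDimensionLT_of_ge M 0 _ (by omega)
  | k + 1 =>
    exact ⟨hT.hasProjectiveDimensionLT_of_homModule hfin k M hM,
      hT.hasProjectiveDimensionLT_homModule hfin hQ k M hM⟩

theorem IsTiltingModule.globalDimension_endOp_le {Q : ModuleCat.{u} Γ} [Injective Q]
    (hQ : GeneratedBy Q T) : globalDimension (EndOp T) ≤ globalDimension Γ := by
  have := hT.finite
  have hfin (M : ModuleCat.{u} Γ) (h : Module.Finite Γ M) :
      Module.Finite (EndOp T) (homModule T M) :=
    have := hnoeth M h
    inferInstance
  rw [globalDimension_le_iff]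
  intro N hN
  have hle : ∀ (M : ModuleCat.{u} Γ), Module.Finite Γ M →
      projectiveDimension M ≤ globalDimension Γ := globalDimension_le_iff.1 le_rfl
  obtain hd | hd | ⟨k, hd⟩ : globalDimension Γ = ⊥ ∨ globalDimension Γ = ⊤ ∨
      ∃ k : ℕ, globalDimension Γ = k := by
    generalize globalDimension Γ = d
    induction d using WithBot.recBotCoe with
    | bot => exact Or.inl rfl
    | coe d =>
      induction d using ENat.recTopCoe with
      | top => exact Or.inr (Or.inl rfl)
      | coe k => exact Or.inr (Or.inr ⟨k, rfl⟩)
  -- Global dimension ⊥ forces T = 0, so `EndOp T` is the zero ring.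
  · have hT₀ : Limits.IsZero T :=
      (projectiveDimension_eq_bot_iff T).1 (le_bot_iff.1 (hd ▸ hle T this))
    have : Subsingleton (EndOp T) :=
      ⟨fun a b => MulOpposite.unop_injective (hT₀.eq_of_src (Y := T) a.unop b.unop)⟩
    have : Subsingleton N := Module.subsingleton (EndOp T) N
    rw [(projectiveDimension_eq_bot_iff N).2 (ModuleCat.isZero_of_subsingleton N)]
    exact bot_le
  · rw [hd]
    exact le_top
  · rw [hd] at hle ⊢
    simp_rw [projectiveDimension_le_iff] at hle ⊢
    obtain ⟨m, M, j, π, w, hM, hS⟩ := hT.exists_syzygy_eq_homModule hnoeth N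
    have hMfin := hM.finite
    have hproj := (FactorsThroughSum.of_pi T m).projective_preadditiveCoyonedaObj
    match k with
    | 0 =>
      have : Module.Finite Γ (ModuleCat.of Γ (Fin m → T)) :=
        inferInstanceAs (Module.Finite Γ (Fin m → T))
      -- In dimension 0 the syzygy bound would only give pd N ≤ 1. Regularity of j, with injectivity
      -- of Hom(T, j), splits j instead, so N is projective.
      obtain ⟨r, hr⟩ := exists_comp_comp_eq_self_of_forall_projective
        (fun M h => projective_iff_hasProjectiveDimensionLT_one.2 (hle M h)) j
      have := hS.mono_f
      have hjr : j ≫ r = 𝟙 M := hM.hom_eq fun g => by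
        refine ((ModuleCat.mono_iff_injective ((preadditiveCoyonedaObj T).map j)).1 this) ?_
        change (g ≫ j ≫ r) ≫ j = (g ≫ 𝟙 M) ≫ j
        rw [Category.assoc, Category.assoc, hr, Category.comp_id]
      let τ := ShortComplex.Splitting.ofExactOfRetraction _ hS.exact
        ((preadditiveCoyonedaObj T).map r)
        (by rw [← Functor.map_comp, hjr]; exact CategoryTheory.Functor.map_id _ M) hS.epi_g
      have ρ : Retract N (homModule T (ModuleCat.of Γ (Fin m → T))) := ⟨τ.s, π, τ.s_g⟩
      exact ρ.hasProjectiveDimensionLT 1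
    | k + 1 =>
      exact hS.hasProjectiveDimensionLT_X₃ (k + 1)
        (hT.hasProjectiveDimensionLT_homModule hfin hQ k M hM (hle M hMfin))
        (hasProjectiveDimensionLT_of_ge (homModule T _) 1 _ (by omega))

/-- In an embedding of X into Y in Gen T with cokernel of pd ≤ 1, pd X is at most max(pd Y, 0), and
pd Y exceeds pd Hom(T, Y) by at most one when Y ≠ 0. -/
theorem IsTiltingModule.globalDimension_le_add_one :
    globalDimension Γ ≤ globalDimension (EndOp T) + 1 := by
  have := hT.finite
  have hfin (M : ModuleCat.{u} Γ) (h : Module.Finite Γ M) :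
      Module.Finite (EndOp T) (homModule T M) :=
    have := hnoeth M h
    inferInstance
  rw [globalDimension_le_iff]
  intro X hX
  obtain ⟨S, hS, rfl, h₂, h₃⟩ := hT.exists_coresolution_of_finite X
  have hle : projectiveDimension (homModule T S.X₂) ≤ globalDimension (EndOp T) :=
    globalDimension_le_iff.1 le_rfl _ (hfin _ h₂.finite)
  generalize globalDimension (EndOp T) = d at hle
  induction d using WithBot.recBotCoe with
  | bot =>
    have hz := h₂.isZero_of_isZero_homModule
      ((projectiveDimension_eq_bot_iff _).1 (le_bot_iff.1 hle))
    have := hS.mono_f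
    rw [(projectiveDimension_eq_bot_iff _).2 (Limits.IsZero.of_mono S.f hz)]
    exact bot_le
  | coe d =>
    induction d using ENat.recTopCoe with
    | top => exact le_top
    | coe k =>
      have hk := hT.hasProjectiveDimensionLT_of_homModule hfin k _ h₂
        ((projectiveDimension_le_iff _ k).1 hle)
      exact (projectiveDimension_le_iff S.X₁ (k + 1)).2
        (hS.hasProjectiveDimensionLT_X₁ (k + 2) hk (hasProjectiveDimensionLT_of_ge _ 2 _ (by omega)))

end GlobalDimension

theorem mainTheorem7 {R : Type*} [CommRing R] [IsArtinianRing R]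
    {Γ : Type u} [Ring Γ] [Algebra R Γ] [Module.Finite R Γ]
    (hdom : 2 ≤ dominantDimension Γ)
    (T : ModuleCat.{u} Γ) (hT : IsTiltingModule T) (hTC : InGenCogenProjInj T) :
    (∀ M : ModuleCat.{u} Γ, GeneratedBy T M → 1 ≤ projectiveDimension M →
      projectiveDimension (homModule T M) + 1 = projectiveDimension M) ∧
    globalDimension (EndOp T) ≤ globalDimension Γ ∧
    (globalDimension (EndOp T) = globalDimension Γ ∨
      globalDimension (EndOp T) + 1 = globalDimension Γ) := by
  obtain ⟨Q, hQ, hQT, -⟩ := hTC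
  have := hQ.injective
  have := hT.finite
  have := isNoetherianRing_of_finite_artinian R (Γ := Γ)
  have hnoeth (M : ModuleCat.{u} Γ) (_ : Module.Finite Γ M) :
      IsNoetherian (EndOp T) (homModule T M) := isNoetherian_homModule R T M
  have hle := hT.globalDimension_endOp_le hnoeth hQT
  exact ⟨fun M hM hpd => hT.projectiveDimension_homModule_add_one hnoeth hQT hM hpd, hle,
    WithBot.eq_or_add_one_eq_of_le_of_le hle (hT.globalDimension_le_add_one hnoeth)⟩
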